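/- Let $\mathbb X,\mathbb Y$ be finite-dimensional real inner product spaces, $\varphi\colon\mathbb X\to\mathbb R$ locally Lipschitz continuous, $\Phi\colon\mathbb X\rightrightarrows\mathbb Y$ a set-valued mapping with closed graph $\operatorname{gph}\Phi$, $\bar y\in\mathbb Y$, and $\Phi^{-1}(\bar y)=\{x\mid \bar y\in\Phi(x)\}$. Let $\mathbb S_{\mathbb X}$ be the unit sphere of $\mathbb X$; $t_k\searrow0$ means $t_k>0$, $t_k\to0$. **Notation.** For a closed set $Q$ and $z\in Q$, the tangent cone $\mathcal T_Q(z)$ is the set of all $d$ for which there are $d_k\to d$, $t_k\searrow 0$ with $z+t_kd_k\in Q$; $\widehat{\mathcal N}_Q(z)$ is the set of all $\eta$ with $\langle\eta,z'-z\rangle\le o(\|z'-z\|)$ for $z'\in Q$, $z'\to z$; and $\mathcal N_Q(z)$ is the set of all limits of $\eta_k\in\widehat{\mathcal N}_Q(z_k)$ with $z_k\in Q$, $z_k\to z$. All three are empty for $z\notin Q$. With $\operatorname{epi}\varphi=\{(x,\alpha)\in\mathbb X\times\mathbb R\mid\varphi(x)\le\alpha\}$, let $\widehat\partial\varphi(x)$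 (respectively $\partial\varphi(x)$) be the set of all $\eta$ such that $(\eta,-1)$ lies in $\widehat{\mathcal N}_{\operatorname{epi}\varphi}(x,\varphi(x))$ (respectively $\mathcal N_{\operatorname{epi}\varphi}(x,\varphi(x))$). Let $\widehat D^*\Phi(x,y)(y^*)$ (respectively $D^*\Phi(x,y)(y^*)$) be the set of all $x^*$ such that $(x^*,-y^*)$ lies in $\widehat{\mathcal N}_{\operatorname{gph}\Phi}(x,y)$ (respectively $\mathcal N_{\operatorname{gph}\Phi}(x,y)$), and let $\ker D\Phi(\bar x,\bar y)=\{u\mid (u,0)\in\mathcal T_{\operatorname{gph}\Phi}(\bar x,\bar y)\}$. For $\gamma\ge1$, $u\in\mathbb S_{\mathbb X}$ and $v\in\mathbb Y$, the pseudo-coderivative $D^*_\gamma\Phi((\bar x,\bar y);(u,v))(y^*)$ is the set of all $x^*$ for which there are $u_k\to u$, $v_k\to v$, $t_k\searrow0$, $x_k^*\to x^*$, $y_k^*\to y^*$ with $$\Big(x_k^*,-\frac{y_k^*}{(t_k\|u_k\|)^{\gamma-1}}\Big)\in\widehat{\mathcal N}_{\operatorname{gph}\Phi}\big(\bar x+t_ku_k,\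 \bar y+(t_k\|u_k\|)^\gamma v_k\big)\quad\text{for all }k.$$ Gfrerer's pseudo-coderivative $\widetilde D^*_\gamma\Phi((\bar x,\bar y);(u,v))(y^*)$ is defined in the same way, with $\bar y+t_kv_k$ in place of $\bar y+(t_k\|u_k\|)^\gamma v_k$. A direction $u\in\mathbb S_{\mathbb X}$ is *critical* at $\bar x$ if there are $u_k\to u$, $v_k\to0$, $t_k\searrow0$ with $(\bar x+t_ku_k,\bar y+t_kv_k)\in\operatorname{gph}\Phi$ for all $k$ and $\limsup_{k\to\infty}(\varphi(\bar x+t_ku_k)-\varphi(\bar x))/t_k\le0$. $\Phi$ is *metrically pseudo-subregular of order $\gamma$ in direction $u$* at $(\bar x,\bar y)$ if there are $\varepsilon,\delta,\kappa>0$ such that $$\|x-\bar x\|^{\gamma-1}\operatorname{dist}(x,\Phi^{-1}(\bar y))\le\kappa\operatorname{dist}(\bar y,\Phi(x))$$ for all $x$ such that $w=x-\bar x$ satisfies $\|w\|\le\varepsilon$ and $\big\|\|w\|u-\|u\|w\big\|\le\delta\|u\|\|w\|$, where $\operatorname{dist}(\cdot,\varnothing)=\infty$. **Theorem.** Let $\bar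 x$ be a local minimizer of $\min\{\varphi(x)\mid\bar y\in\Phi(x)\}$ (in particular, $\bar y\in\Phi(\bar x)$) and let $\gamma\ge1$. Then at least one of the following holds. (i) $\bar x$ is M-stationary: there is $\lambda\in\mathbb Y$ with $0\in\partial\varphi(\bar x)+D^*\Phi(\bar x,\bar y)(\lambda)$. (ii) There is a critical direction $u\in\mathbb S_{\mathbb X}$ at $\bar x$ with $0\in\partial\varphi(\bar x)+\widetilde D^*_\gamma\Phi((\bar x,\bar y);(u,0))(0)$. (iii) There are a critical direction $u\in\mathbb S_{\mathbb X}$ at $\bar x$, some $v\in\mathbb Y$ and some $\lambda\in\mathbb Y\setminus\{0\}$ with $\langle\lambda,v\rangle\ge0$ and $0\in\partial\varphi(\bar x)+D^*_\gamma\Phi((\bar x,\bar y);(u,v))(\lambda)$. (iv) There are a critical direction $u\in\mathbb S_{\mathbb X}$ at $\bar x$, sequences $x_k,x_k',\eta_k\in\mathbb X$ and $y_k,y_k^*\in\mathbb Y$, and $y^*\in\mathbb Y$ such that $x_k,x_k'\notin\Phi^{-1}(\bar y)$, $y_k\ne\bar y$ and $y_k^*\ne0$ for all $k$ and, with $$v_k^\gamma:=\frac{y_k-\bar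 y}{\|x_k-\bar x\|^\gamma},\qquad\lambda_k^\gamma:=\frac{\|x_k-\bar x\|^\gamma}{\|y_k-\bar y\|}\,y_k^*,$$ one has $x_k\to\bar x$, $x_k'\to\bar x$, $y_k\to\bar y$, $\frac{x_k-\bar x}{\|x_k-\bar x\|}\to u$, $\frac{x_k'-\bar x}{\|x_k'-\bar x\|}\to u$, $v_k^\gamma\to0$, $y_k^*\to y^*$, $\|\lambda_k^\gamma\|\to\infty$, $\eta_k\to0$, $\frac{y_k-\bar y}{\|y_k-\bar y\|}-\frac{\lambda_k^\gamma}{\|\lambda_k^\gamma\|}\to0$, and $$\eta_k\in\widehat\partial\varphi(x_k')+\widehat D^*\Phi(x_k,y_k)\Big(\frac{\lambda_k^\gamma}{\|x_k-\bar x\|^{\gamma-1}}\Big)\quad\text{for all }k.$$ Moreover, if $\Phi$ is metrically pseudo-subregular of order $\gamma$ at $(\bar x,\bar y)$ in every direction $u\in\ker D\Phi(\bar x,\bar y)\cap\mathbb S_{\mathbb X}$, then at least one of (i), (ii), (iii) holds. -/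

import Mathlib

open Filter
open scoped Topology Pointwise

namespace VarAnalysis

section Cones

variable {E : Type*} [NormedAddCommGroup E] [InnerProductSpace ℝ E]

/-- A sequence of positive reals converging to zero, `t k ↘ 0`. -/
def PosNull (t : ℕ → ℝ) : Prop :=
  (∀ k, 0 < t k) ∧ Tendsto t atTop (𝓝 0)

/-- The (Bouligand) tangent cone to `Q` at `x`, empty if `x ∉ Q`. -/
def tangentCone (Q : Set E) (x : E) : Set E :=
  {d | x ∈ Q ∧ ∃ (dk : ℕ → E) (t : ℕ → ℝ), Tendsto dk atTop (𝓝 d) ∧ PosNull t ∧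
    ∀ k, x + t k • dk k ∈ Q}

/-- The regular (Fréchet) normal cone to `Q` at `x`, i.e. all `η` such that
`⟪η, x' - x⟫ ≤ o(‖x' - x‖)` for `x' ∈ Q`, `x' → x`; empty if `x ∉ Q`. -/
def regularNormalCone (Q : Set E) (x : E) : Set E :=
  {η | x ∈ Q ∧ ∀ ε : ℝ, 0 < ε → ∀ᶠ x' in 𝓝[Q] x, inner ℝ η (x' - x) ≤ ε * ‖x' - x‖}

/-- The limiting (Mordukhovich) normal cone to `Q` at `x`; empty if `x ∉ Q`. -/
def limitingNormalCone (Q : Set E) (x : E) : Set E :=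
  {η | x ∈ Q ∧ ∃ xk ηk : ℕ → E, (∀ k, xk k ∈ Q) ∧
    Tendsto xk atTop (𝓝 x) ∧ Tendsto ηk atTop (𝓝 η) ∧
    ∀ k, ηk k ∈ regularNormalCone Q (xk k)}

end Cones

section Maps

variable {X Y : Type*} [NormedAddCommGroup X] [InnerProductSpace ℝ X]
  [NormedAddCommGroup Y] [InnerProductSpace ℝ Y]

/-- The pair `(x, y)` as a point of the product `X × Y` with its Euclidean structure. -/
abbrev pair (x : X) (y : Y) : WithLp 2 (X × Y) := WithLp.toLp 2 (x, y)

/-- The epigraph of `φ`, in the Euclidean product `X × ℝ`. -/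
def epi (φ : X → ℝ) : Set (WithLp 2 (X × ℝ)) := {p | φ p.fst ≤ p.snd}

/-- The regular (Fréchet) subdifferential of `φ` at `x`. -/
def regularSubdiff (φ : X → ℝ) (x : X) : Set X :=
  {η | pair η (-1 : ℝ) ∈ regularNormalCone (epi φ) (pair x (φ x))}

/-- The limiting (Mordukhovich) subdifferential of `φ` at `x`. -/
def limitingSubdiff (φ : X → ℝ) (x : X) : Set X :=
  {η | pair η (-1 : ℝ) ∈ limitingNormalCone (epi φ) (pair x (φ x))}

/-- The graph of the set-valued mapping `Φ`, in the Euclidean product `X × Y`. -/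
def gph (Φ : X → Set Y) : Set (WithLp 2 (X × Y)) := {p | p.snd ∈ Φ p.fst}

/-- The value `Φ⁻¹(y)` of the inverse mapping. -/
def invMap (Φ : X → Set Y) (y : Y) : Set X := {x | y ∈ Φ x}

/-- The kernel of a set-valued mapping. -/
def kerMap (Φ : X → Set Y) : Set X := {x | 0 ∈ Φ x}

/-- The graphical derivative `DΦ(x, y)`. -/
def graphicalDerivative (Φ : X → Set Y) (x : X) (y : Y) : X → Set Y :=
  fun u => {v | pair u v ∈ tangentCone (gph Φ) (pair x y)}

/-- The regular coderivative of `Φ` at `(x, y)`. -/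
def regularCoderivative (Φ : X → Set Y) (x : X) (y : Y) : Y → Set X :=
  fun ys => {xs | pair xs (-ys) ∈ regularNormalCone (gph Φ) (pair x y)}

/-- The limiting coderivative of `Φ` at `(x, y)`. -/
def limitingCoderivative (Φ : X → Set Y) (x : X) (y : Y) : Y → Set X :=
  fun ys => {xs | pair xs (-ys) ∈ limitingNormalCone (gph Φ) (pair x y)}

/-- The pseudo-coderivative of order `γ` of `Φ` at `(x, y)` in direction `(u, v)`
(used only for `‖u‖ = 1`, where `uk k = 0` occurs for finitely many `k` at most). -/
def pseudoCoderivative (γ : ℝ) (Φ : X → Set Y) (x : X) (y : Y) (u : X) (v : Y) : Y → Set X :=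
  fun ys => {xs | ∃ (uk xsk : ℕ → X) (vk ysk : ℕ → Y) (t : ℕ → ℝ),
    Tendsto uk atTop (𝓝 u) ∧ Tendsto vk atTop (𝓝 v) ∧ PosNull t ∧
    Tendsto xsk atTop (𝓝 xs) ∧ Tendsto ysk atTop (𝓝 ys) ∧
    ∀ k, pair (xsk k) (-(((t k * ‖uk k‖) ^ (γ - 1))⁻¹ • ysk k)) ∈
      regularNormalCone (gph Φ)
        (pair (x + t k • uk k) (y + ((t k * ‖uk k‖) ^ γ) • vk k))}

/-- Gfrerer's pseudo-coderivative of order `γ` of `Φ` at `(x, y)` in direction `(u, v)`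
(used only for `‖u‖ = 1`, where `uk k = 0` occurs for finitely many `k` at most). -/
def gfrererPseudoCoderivative (γ : ℝ) (Φ : X → Set Y) (x : X) (y : Y) (u : X) (v : Y) :
    Y → Set X :=
  fun ys => {xs | ∃ (uk xsk : ℕ → X) (vk ysk : ℕ → Y) (t : ℕ → ℝ),
    Tendsto uk atTop (𝓝 u) ∧ Tendsto vk atTop (𝓝 v) ∧ PosNull t ∧
    Tendsto xsk atTop (𝓝 xs) ∧ Tendsto ysk atTop (𝓝 ys) ∧
    ∀ k, pair (xsk k) (-(((t k * ‖uk k‖) ^ (γ - 1))⁻¹ • ysk k)) ∈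
      regularNormalCone (gph Φ) (pair (x + t k • uk k) (y + t k • vk k))}

/-- The directional neighborhood `𝔹_{ε,δ}(u)` of `u`. -/
def dirNhd (ε δ : ℝ) (u : X) : Set X :=
  {v | ‖‖v‖ • u - ‖u‖ • v‖ ≤ δ * ‖u‖ * ‖v‖ ∧ ‖v‖ ≤ ε}

/-- Metric pseudo-subregularity of order `γ` of `Φ` at `(xb, yb)` in direction `u`.
Distances are extended-real-valued: the distance to the empty set is `∞`. -/
def MetricallyPseudoSubregular (γ : ℝ) (Φ : X → Set Y) (xb : X) (yb : Y) (u : X) : Prop :=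
  ∃ ε δ κ : ℝ, 0 < ε ∧ 0 < δ ∧ 0 < κ ∧ ∀ x : X, x - xb ∈ dirNhd ε δ u →
    ENNReal.ofReal (‖x - xb‖ ^ (γ - 1)) * Metric.infEDist x (invMap Φ yb) ≤
      ENNReal.ofReal κ * Metric.infEDist yb (Φ x)

/-- M-stationarity of `xb` for the problem `min φ(x)` subject to `yb ∈ Φ(x)`. -/
def IsMStationary (φ : X → ℝ) (Φ : X → Set Y) (xb : X) (yb : Y) : Prop :=
  yb ∈ Φ xb ∧ ∃ lam : Y, 0 ∈ limitingSubdiff φ xb + limitingCoderivative Φ xb yb lam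

/-- `u` is a critical (unit) direction at `xb` for the problem `min φ(x)` subject to
`yb ∈ Φ(x)`. The upper limit is taken in the extended reals. -/
def IsCriticalDirection (φ : X → ℝ) (Φ : X → Set Y) (xb : X) (yb : Y) (u : X) : Prop :=
  u ∈ Metric.sphere (0 : X) 1 ∧
  ∃ (uk : ℕ → X) (vk : ℕ → Y) (t : ℕ → ℝ),
    Tendsto uk atTop (𝓝 u) ∧ Tendsto vk atTop (𝓝 0) ∧ PosNull t ∧
    (∀ k, pair (xb + t k • uk k) (yb + t k • vk k) ∈ gph Φ) ∧
    limsup (fun k => (((φ (xb + t k • uk k) - φ xb) / t k : ℝ) : EReal)) atTop ≤ 0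

/-- Directional approximate stationarity of order `γ` at `xb` along `u`, with a diverging
sequence of multipliers `lam k`. -/
def IsApproxStationaryAlong (γ : ℝ) (φ : X → ℝ) (Φ : X → Set Y) (xb : X) (yb : Y) (u : X) :
    Prop :=
  ∃ (x x' η : ℕ → X) (y ys v lam : ℕ → Y) (yStar : Y),
    (∀ k, x k ∉ invMap Φ yb ∧ x' k ∉ invMap Φ yb ∧ y k ≠ yb ∧ ys k ≠ 0) ∧
    (∀ k, v k = (‖x k - xb‖ ^ γ)⁻¹ • (y k - yb)) ∧
    (∀ k, lam k = (‖x k - xb‖ ^ γ / ‖y k - yb‖) • ys k) ∧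
    Tendsto x atTop (𝓝 xb) ∧ Tendsto x' atTop (𝓝 xb) ∧ Tendsto y atTop (𝓝 yb) ∧
    Tendsto (fun k => ‖x k - xb‖⁻¹ • (x k - xb)) atTop (𝓝 u) ∧
    Tendsto (fun k => ‖x' k - xb‖⁻¹ • (x' k - xb)) atTop (𝓝 u) ∧
    Tendsto v atTop (𝓝 0) ∧
    Tendsto ys atTop (𝓝 yStar) ∧
    Tendsto (fun k => ‖lam k‖) atTop atTop ∧
    Tendsto η atTop (𝓝 0) ∧
    Tendsto (fun k => ‖y k - yb‖⁻¹ • (y k - yb) - ‖lam k‖⁻¹ • lam k) atTop (𝓝 0) ∧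
    ∀ k, η k ∈ regularSubdiff φ (x' k) +
      regularCoderivative Φ (x k) (y k) ((‖x k - xb‖ ^ (γ - 1))⁻¹ • lam k)

end Maps

end VarAnalysis

open VarAnalysis

/-! Replace the constraint by a quadratic penalty: minimize `φ x + ‖x - xb‖² + k‖y - yb‖²` over the
graph of `Φ` near `(xb, yb)`. For suitable `k` a minimizer `(a, b)` is as close to `(xb, yb)` as
desired (`exists_penalized_local_min`), and a fuzzy sum rule there (`exists_fuzzy_multipliers`)
yields a regular subgradient and a regular coderivative element that nearly cancel, with multiplier
`lam` close to `2k(b - yb)`. So `lam` is nearly aligned with `y - yb`.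

The decisive estimate is `‖lam‖ ‖y - yb‖ ≤ C dist(x, Φ⁻¹(yb))`. If `p` is the projection of `a` onto
`Φ⁻¹(yb)`, then local minimality and the Lipschitz property give `k‖b - yb‖² ≤ φ xb - φ a ≤ φ p - φ
a ≤ L‖p - a‖`.

Let the tolerance tend to zero and write `t = ‖x - xb‖`. A bounded subsequence of `lam` gives
M-stationarity. Otherwise `(y - yb)/t → 0`, so the limit direction is critical. Set `Λ = t^(γ-1)
lam` and `v = t^(-γ)(y - yb)`; then `‖Λ‖ ‖v‖ ≤ C` whatever `γ` is. If `Λ` has a subsequence with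
limit zero, (ii) follows; if it has one with a nonzero limit, `v` is bounded along a subsequence and
(iii) follows; if `‖Λ‖ → ∞`, then `v → 0` and (iv) follows. Pseudo-subregularity bounds `‖Λ‖`
through the decisive estimate and so excludes the last case. -/

namespace VarAnalysis

/-! ### Exact-limit penalization on compact sets -/

/-- Minimizers of a penalized function over a compact set approach a strict constrained
minimizer. -/
lemma exists_penalty_minimizer {α : Type*} [TopologicalSpace α] {K : Set α} (hK : IsCompact K)
    {f g : α → ℝ} (hf : Continuous f) (hg : Continuous g) (hg0 : ∀ p, 0 ≤ g p) {q : α}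
    (hq : q ∈ K) (hgq : g q = 0) (hstrict : ∀ p ∈ K, g p = 0 → f p ≤ f q → p = q)
    {U : Set α} (hU : U ∈ 𝓝 q) :
    ∃ c : ℝ, 0 < c ∧ ∃ p ∈ K, p ∈ U ∧ ∀ z ∈ K, f p + c * g p ≤ f z + c * g z := by
  have hK' : IsCompact (K \ interior U) := hK.diff isOpen_interior
  -- Away from `q` the penalized value exceeds `f q` for large weights; these open sets increase
  -- with the weight, so by compactness one weight serves all points. The shift `n + 1` keeps it
  -- positive.
  obtain ⟨n, hn⟩ := hK'.elim_directed_cover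
    (fun n : ℕ => {p | f q < f p + (n + 1) * g p})
    (fun n => isOpen_lt continuous_const (by fun_prop))
    (by
      rintro p ⟨hpK, hpU⟩
      have hne : p ≠ q := fun h => hpU (h ▸ mem_interior_iff_mem_nhds.2 hU)
      rw [Set.mem_iUnion]
      rcases (hg0 p).eq_or_lt with h0 | h0
      · refine ⟨0, ?_⟩
        have : ¬ f p ≤ f q := fun h => hne (hstrict p hpK h0.symm h)
        simp only [Set.mem_ofPred_eq, ← h0]
        linarith
      · obtain ⟨n, hn⟩ := exists_nat_gt ((f q - f p) / g p)
        refine ⟨n, ?_⟩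
        rw [div_lt_iff₀ h0] at hn
        simp only [Set.mem_ofPred_eq]
        nlinarith)
    (by
      refine Monotone.directed_le fun m n hmn p hp => ?_
      simp only [Set.mem_ofPred_eq] at hp ⊢
      have h1 : (m : ℝ) ≤ n := by exact_mod_cast hmn
      nlinarith [hg0 p])
  obtain ⟨p, hpK, hp⟩ := hK.exists_isMinOn ⟨q, hq⟩
    (f := fun p => f p + ((n : ℝ) + 1) * g p) (by fun_prop)
  refine ⟨n + 1, by positivity, p, hpK, ?_, fun z hz => hp hz⟩
  by_contra hpU
  have h1 := hn ⟨hpK, fun h => hpU (interior_subset h)⟩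
  have h2 : f p + ((n : ℝ) + 1) * g p ≤ f q + ((n : ℝ) + 1) * g q := hp hq
  simp only [Set.mem_ofPred_eq] at h1
  rw [hgq] at h2
  linarith

/-! ### Regular normals, regular subgradients and normalized vectors -/

section Normals

variable {E : Type*} [NormedAddCommGroup E] [InnerProductSpace ℝ E]

lemma mem_regularNormalCone_of_quadratic {Q : Set E} {x η : E} (hx : x ∈ Q) (c : ℝ)
    (h : ∀ᶠ z in 𝓝[Q] x, inner ℝ η (z - x) ≤ c * ‖z - x‖ ^ 2) : η ∈ regularNormalCone Q x := by
  refine ⟨hx, fun ε hε => ?_⟩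
  have h1 : Tendsto (fun z => c * ‖z - x‖) (𝓝[Q] x) (𝓝 0) := by
    have : Continuous fun z => c * ‖z - x‖ := by fun_prop
    simpa using (this.tendsto x).mono_left nhdsWithin_le_nhds
  filter_upwards [h, h1.eventually_lt_const hε] with z hz hz1
  nlinarith [norm_nonneg (z - x)]

end Normals

variable {X Y : Type*} [NormedAddCommGroup X] [InnerProductSpace ℝ X]
  [NormedAddCommGroup Y] [InnerProductSpace ℝ Y]

lemma inner_pair_sub (p q x : X) (r s y : Y) :
    inner ℝ (pair p r) (pair q s - pair x y) = inner ℝ p (q - x) + inner ℝ r (s - y) := by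
  simp [pair, ← WithLp.toLp_sub, WithLp.prod_inner_apply]

lemma norm_pair_sub_sq (x a : X) (y b : Y) :
    ‖pair x y - pair a b‖ ^ 2 = ‖x - a‖ ^ 2 + ‖y - b‖ ^ 2 := by
  simp [pair, ← WithLp.toLp_sub, WithLp.prod_norm_sq_eq_of_L2]

lemma mem_regularSubdiff_of_quadratic {φ : X → ℝ} {x ξ : X} {c : ℝ} (hc : 0 ≤ c)
    (h : ∀ᶠ z in 𝓝 x, φ x + inner ℝ ξ (z - x) - c * ‖z - x‖ ^ 2 ≤ φ z) :
    ξ ∈ regularSubdiff φ x := by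
  refine mem_regularNormalCone_of_quadratic (le_refl (φ x)) c ?_
  have hcont : Tendsto (fun p : WithLp 2 (X × ℝ) => p.fst) (𝓝[epi φ] (pair x (φ x))) (𝓝 x) := by
    have : Continuous fun p : WithLp 2 (X × ℝ) => p.fst := by fun_prop
    exact (this.tendsto (pair x (φ x))).mono_left nhdsWithin_le_nhds
  filter_upwards [hcont.eventually h, self_mem_nhdsWithin] with p hp hpe
  have h1 := inner_pair_sub ξ p.fst x (-1 : ℝ) p.snd (φ x)
  have h2 := norm_pair_sub_sq p.fst x p.snd (φ x)
  have h3 : φ p.fst ≤ p.snd := hpe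
  change inner ℝ (pair ξ (-1 : ℝ)) (p - pair x (φ x)) = _ at h1
  change ‖p - pair x (φ x)‖ ^ 2 = _ at h2
  rw [h1, h2]
  have h4 : inner ℝ (-1 : ℝ) (p.snd - φ x) = -(p.snd - φ x) := by simp
  rw [h4]
  have := mul_nonneg hc (sq_nonneg ‖p.snd - φ x‖)
  linarith

/-- Test the normal inequality at the graph points over `x + t • ξ`, `t ↓ 0`: the gain `t‖ξ‖²` is at
most the Lipschitz growth `L t‖ξ‖` plus an arbitrarily small multiple of `t‖ξ‖`. -/
lemma norm_le_of_mem_regularSubdiff {φ : X → ℝ} {x ξ : X} {L : NNReal} {s : Set X}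
    (hs : s ∈ 𝓝 x) (hL : LipschitzOnWith L φ s) (h : ξ ∈ regularSubdiff φ x) : ‖ξ‖ ≤ L := by
  have key : ∀ ε : ℝ, 0 < ε → ‖ξ‖ ≤ L + ε * (1 + L) := by
    intro ε hε
    rcases eq_or_ne ξ 0 with rfl | hξ
    · simp; positivity
    have hξ' := norm_pos_iff.2 hξ
    have hev := h.2 ε hε
    have hφ : ContinuousAt φ x := hL.continuousOn.continuousAt hs
    let c : ℝ → X := fun t => x + t • ξ
    have hc : Tendsto c (𝓝[>] 0) (𝓝 x) := by
      have : Continuous c := by fun_prop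
      simpa [c] using (this.tendsto 0).mono_left nhdsWithin_le_nhds
    have h1 : Tendsto (fun t => pair (c t) (φ (c t))) (𝓝[>] 0) (𝓝[epi φ] (pair x (φ x))) := by
      refine tendsto_nhdsWithin_iff.2 ⟨?_, Eventually.of_forall fun t => le_refl (φ (c t))⟩
      exact ((WithLp.prod_continuous_toLp 2 X ℝ).tendsto _).comp
        (hc.prodMk_nhds (hφ.tendsto.comp hc))
    obtain ⟨t, ⟨ht, hts⟩, ht0⟩ :=
      (((h1.eventually hev).and (hc.eventually hs)).and self_mem_nhdsWithin).exists
    have ht0 : 0 < t := ht0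
    rw [inner_pair_sub] at ht
    have hx : x ∈ s := mem_of_mem_nhds hs
    have hlip : |φ (c t) - φ x| ≤ L * (t * ‖ξ‖) := by
      have := hL.norm_sub_le hts hx
      simpa [c, norm_smul, abs_of_pos ht0] using this
    have hcx : c t - x = t • ξ := by simp [c]
    have hn : ‖pair (c t) (φ (c t)) - pair x (φ x)‖ ≤ t * ‖ξ‖ * (1 + L) := by
      refine abs_le_of_sq_le_sq' ?_ (by positivity) |>.2
      rw [norm_pair_sub_sq, hcx, norm_smul, Real.norm_eq_abs, Real.norm_eq_abs, sq_abs,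
        abs_of_pos ht0]
      have h5 := sq_le_sq' (by linarith [abs_nonneg (φ (c t) - φ x)]) hlip
      rw [sq_abs] at h5
      have : 0 ≤ (t * ‖ξ‖) ^ 2 * L := by positivity
      nlinarith
    have h4 : inner ℝ (-1 : ℝ) (φ (c t) - φ x) = -(φ (c t) - φ x) := by simp
    rw [h4, hcx, inner_smul_right, real_inner_self_eq_norm_sq] at ht
    have h6 := (abs_le.1 hlip).2
    have h7 := mul_le_mul_of_nonneg_left hn hε.le
    have h8 : (t * ‖ξ‖) * ‖ξ‖ ≤ (t * ‖ξ‖) * (L + ε * (1 + L)) := by nlinarith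
    exact le_of_mul_le_mul_left h8 (by positivity)
  refine le_of_forall_pos_le_add fun δ hδ => ?_
  have h1 : (0 : ℝ) < 1 + L := by positivity
  have := key (δ / (1 + L)) (by positivity)
  rwa [div_mul_cancel₀ _ h1.ne'] at this

lemma norm_sq_expand (w x c : X) :
    ‖w - c‖ ^ 2 = ‖x - c‖ ^ 2 + 2 * inner ℝ (x - c) (w - x) + ‖w - x‖ ^ 2 := by
  have : w - c = (x - c) + (w - x) := by abel
  rw [this, norm_add_sq_real]

lemma norm_normalize_sub_le (p : X) {q : X} (hq : q ≠ 0) :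
    ‖‖p‖⁻¹ • p - ‖q‖⁻¹ • q‖ ≤ 2 * ‖p - q‖ / ‖q‖ := by
  have hq' := norm_pos_iff.2 hq
  rw [le_div_iff₀ hq']
  have h1 : ‖q‖ * ‖‖p‖⁻¹ • p - ‖q‖⁻¹ • q‖ = ‖(‖q‖ - ‖p‖) • (‖p‖⁻¹ • p) + (p - q)‖ := by
    rw [← norm_smul_of_nonneg hq'.le]
    congr 1
    rcases eq_or_ne p 0 with rfl | hp
    · simp [smul_smul, hq'.ne']
    · have := (norm_pos_iff.2 hp).ne'
      rw [smul_sub, smul_smul ‖q‖ ‖q‖⁻¹, mul_inv_cancel₀ hq'.ne', sub_smul, smul_smul ‖p‖,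
        mul_inv_cancel₀ this]
      simp
  have h2 : ‖(‖q‖ - ‖p‖) • (‖p‖⁻¹ • p)‖ ≤ ‖p - q‖ := by
    rw [norm_smul, norm_smul, norm_inv, norm_norm, Real.norm_eq_abs]
    have h3 : ‖p‖⁻¹ * ‖p‖ ≤ 1 := inv_mul_le_one
    have h4 := abs_norm_sub_norm_le q p
    rw [norm_sub_rev q p] at h4
    nlinarith [abs_nonneg (‖q‖ - ‖p‖), inv_nonneg.2 (norm_nonneg p), norm_nonneg p]
  calc _ = ‖q‖ * ‖‖p‖⁻¹ • p - ‖q‖⁻¹ • q‖ := mul_comm _ _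
    _ ≤ _ := by rw [h1]; exact norm_add_le _ _ |>.trans (by linarith)

lemma isClosed_gph_prod {Φ : X → Set Y} (hΦ : IsClosed (gph Φ)) :
    IsClosed {q : X × Y | q.2 ∈ Φ q.1} :=
  hΦ.preimage (WithLp.prod_continuous_toLp 2 X Y)

lemma isClosed_invMap {Φ : X → Set Y} (hΦ : IsClosed (gph Φ)) (y : Y) :
    IsClosed (invMap Φ y) :=
  (isClosed_gph_prod hΦ).preimage (f := fun x : X => (x, y)) (by fun_prop)

/-! ### Penalized minimizers and the fuzzy sum rule -/

variable [FiniteDimensional ℝ X] [FiniteDimensional ℝ Y]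

/-- Penalizing the constraint `yb ∈ Φ x` produces local minimizers on the graph of `Φ`
arbitrarily close to `(xb, yb)`. -/
lemma exists_penalized_local_min {φ : X → ℝ} (hφ : Continuous φ) {Φ : X → Set Y}
    (hΦ : IsClosed (gph Φ)) {xb : X} {yb : Y} (hfeas : xb ∈ invMap Φ yb)
    (hmin : IsLocalMinOn φ (invMap Φ yb) xb) {ρ : ℝ} (hρ : 0 < ρ) :
    ∃ k : ℝ, 0 < k ∧ ∃ (a : X) (b : Y) (r : ℝ), 0 < r ∧ b ∈ Φ a ∧ ‖a - xb‖ < ρ ∧ ‖b - yb‖ < ρ ∧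
      φ a + ‖a - xb‖ ^ 2 + k * ‖b - yb‖ ^ 2 ≤ φ xb ∧
      ∀ x y, y ∈ Φ x → ‖x - a‖ ≤ r → ‖y - b‖ ≤ r →
        φ a + ‖a - xb‖ ^ 2 + k * ‖b - yb‖ ^ 2 ≤ φ x + ‖x - xb‖ ^ 2 + k * ‖y - yb‖ ^ 2 := by
  have : ProperSpace X := FiniteDimensional.proper_real X
  have : ProperSpace Y := FiniteDimensional.proper_real Y
  obtain ⟨δ, hδ, hball⟩ := Metric.mem_nhdsWithin_iff.1 hmin
  set R := min (δ / 2) ρ with hR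
  have hR0 : 0 < R := by positivity
  have hK : IsCompact (Metric.closedBall (xb, yb) R ∩ {q : X × Y | q.2 ∈ Φ q.1}) :=
    (isCompact_closedBall _ _).inter_right (isClosed_gph_prod hΦ)
  -- The term `‖q.1 - xb‖ ^ 2` turns the local minimizer `xb` into a strict one, as the penalty
  -- lemma requires.
  obtain ⟨k, hk, ⟨a, b⟩, ⟨-, hab⟩, hU, hopt⟩ := exists_penalty_minimizer hK
    (f := fun q => φ q.1 + ‖q.1 - xb‖ ^ 2) (g := fun q => ‖q.2 - yb‖ ^ 2) (by fun_prop)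
    (by fun_prop) (fun _ => by positivity) (q := (xb, yb))
    ⟨Metric.mem_closedBall_self hR0.le, hfeas⟩ (by simp)
    (by
      rintro ⟨x, y⟩ ⟨hx, hxy⟩ h0 hle
      have hy : y = yb := by simpa [sub_eq_zero] using h0
      subst hy
      rw [Metric.mem_closedBall, Prod.dist_eq, max_le_iff] at hx
      have hxd : dist x xb ≤ R := hx.1
      have hxb : φ xb ≤ φ x := hball ⟨by
        rw [Metric.mem_ball]; linarith [min_le_left (δ / 2) ρ], hxy⟩
      simp only [sub_self, norm_zero] at hle
      have : ‖x - xb‖ ^ 2 = 0 := by nlinarith [sq_nonneg ‖x - xb‖]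
      have : x = xb := by simpa [sub_eq_zero] using this
      rw [this])
    (Metric.ball_mem_nhds _ hR0)
  rw [Metric.mem_ball, Prod.dist_eq, max_lt_iff] at hU
  simp only [dist_eq_norm] at hU
  have hRρ : R ≤ ρ := min_le_right _ _
  refine ⟨k, hk, a, b, R - max ‖a - xb‖ ‖b - yb‖, sub_pos.2 (max_lt hU.1 hU.2), hab,
    hU.1.trans_le hRρ, hU.2.trans_le hRρ, ?_, fun x y hxy hx hy => ?_⟩
  · simpa using hopt (xb, yb) ⟨Metric.mem_closedBall_self hR0.le, hfeas⟩
  · refine hopt (x, y) ⟨?_, hxy⟩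
    rw [Metric.mem_closedBall, Prod.dist_eq, max_le_iff]
    simp only [dist_eq_norm]
    have h1 := norm_sub_le_norm_sub_add_norm_sub x a xb
    have h2 := norm_sub_le_norm_sub_add_norm_sub y b yb
    have h3 := le_max_left ‖a - xb‖ ‖b - yb‖
    have h4 := le_max_right ‖a - xb‖ ‖b - yb‖
    constructor <;> linarith

/-- A fuzzy sum rule at a local minimizer of the penalized problem. -/
lemma exists_fuzzy_multipliers {φ : X → ℝ} (hφ : Continuous φ) {Φ : X → Set Y}
    (hΦ : IsClosed (gph Φ)) {xb a : X} {yb b : Y} {k r : ℝ} (hk : 0 < k) (hr : 0 < r)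
    (hab : b ∈ Φ a)
    (hmin : ∀ x y, y ∈ Φ x → ‖x - a‖ ≤ r → ‖y - b‖ ≤ r →
      φ a + ‖a - xb‖ ^ 2 + k * ‖b - yb‖ ^ 2 ≤ φ x + ‖x - xb‖ ^ 2 + k * ‖y - yb‖ ^ 2)
    {ε : ℝ} (hε : 0 < ε) :
    ∃ (x x' ξ xs : X) (y lam : Y), ‖x - a‖ < ε ∧ ‖x' - a‖ < ε ∧ ‖y - b‖ < ε ∧
      ‖lam - (2 * k) • (b - yb)‖ < ε ∧ ‖ξ + xs + (2 : ℝ) • (a - xb)‖ < ε ∧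
      ξ ∈ regularSubdiff φ x' ∧ xs ∈ regularCoderivative Φ x y lam := by
  have : ProperSpace X := FiniteDimensional.proper_real X
  have : ProperSpace Y := FiniteDimensional.proper_real Y
  -- The multiplier error below is `(2k + 2)‖y - b‖` and the residual is `4‖x - a‖`; both stay below
  -- `ε`.
  set e := min r (ε / (2 * k + 4)) with he
  have he0 : 0 < e := by positivity
  have hK : IsCompact (Metric.closedBall a r ×ˢ
      (Metric.closedBall (a, b) r ∩ {q : X × Y | q.2 ∈ Φ q.1})) :=
    (isCompact_closedBall _ _).prod
      ((isCompact_closedBall _ _).inter_right (isClosed_gph_prod hΦ))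
  -- Decouple the argument of `φ` from the graph variable and penalize their distance; the proximal
  -- terms at `a` and `b` make `(a, a, b)` a strict minimizer.
  obtain ⟨n, hn, ⟨x', x, y⟩, ⟨hx'K, hxyK, hxy⟩, hU, hopt⟩ := exists_penalty_minimizer hK
    (f := fun q => φ q.1 + ‖q.2.1 - xb‖ ^ 2 + k * ‖q.2.2 - yb‖ ^ 2 + ‖q.2.1 - a‖ ^ 2
      + ‖q.2.2 - b‖ ^ 2)
    (g := fun q => ‖q.1 - q.2.1‖ ^ 2) (by fun_prop)
    (by fun_prop) (fun _ => by positivity) (q := (a, a, b))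
    ⟨Metric.mem_closedBall_self hr.le, Metric.mem_closedBall_self hr.le, hab⟩ (by simp)
    (by
      rintro ⟨x', x, y⟩ ⟨hx', hx, hxy⟩ h0 hle
      have h0 : x' = x := by simpa [sub_eq_zero] using h0
      subst h0
      simp only [Metric.mem_closedBall, Prod.dist_eq, max_le_iff] at hx
      simp only [dist_eq_norm] at hx
      have := hmin x' y hxy hx.1 hx.2
      simp only [sub_self, norm_zero] at hle
      have h1 : ‖x' - a‖ ^ 2 = 0 := by nlinarith [sq_nonneg ‖x' - a‖, sq_nonneg ‖y - b‖]
      have h2 : ‖y - b‖ ^ 2 = 0 := by nlinarith [sq_nonneg ‖x' - a‖, sq_nonneg ‖y - b‖]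
      have h1 : x' = a := by simpa [sub_eq_zero] using h1
      have h2 : y = b := by simpa [sub_eq_zero] using h2
      rw [h1, h2])
    (Metric.ball_mem_nhds _ he0)
  simp only [Metric.mem_ball, Prod.dist_eq, max_lt_iff] at hU
  simp only [dist_eq_norm] at hU
  obtain ⟨hx'e, hxe, hye⟩ := hU
  have her : e ≤ r := min_le_left _ _
  have heε : e * (2 * k + 4) ≤ ε := by
    rw [← le_div_iff₀ (by positivity)]; exact min_le_right _ _
  have heε' : e ≤ ε := by nlinarith
  -- Optimality in the first variable alone, with `(x, y)` frozen.
  have hξ : (2 * n) • (x - x') ∈ regularSubdiff φ x' := by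
    refine mem_regularSubdiff_of_quadratic hn.le ?_
    have hev : ∀ᶠ z in 𝓝 x', z ∈ Metric.ball a r :=
      Metric.isOpen_ball.mem_nhds (by simpa [dist_eq_norm] using hx'e.trans_le her)
    filter_upwards [hev] with z hz
    have h1 := hopt (z, x, y) ⟨Metric.ball_subset_closedBall hz, hxyK, hxy⟩
    simp only at h1
    rw [norm_sq_expand z x' x] at h1
    rw [inner_smul_left, ← neg_sub x' x, inner_neg_left]
    simp only [conj_trivial]
    linarith
  -- Optimality in the graph variable alone, with `x'` frozen. The second-order coefficients are `n
  -- + 2` in `x` and `k + 1` in `y`, both at most `2 + n + k`.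
  have hxs : pair (-((2 * n) • (x - x') + (2 : ℝ) • (x - xb) + (2 : ℝ) • (x - a)))
      (-((2 * k) • (y - yb) + (2 : ℝ) • (y - b))) ∈ regularNormalCone (gph Φ) (pair x y) := by
    refine mem_regularNormalCone_of_quadratic hxy (2 + n + k) ?_
    have hopen : IsOpen {p : WithLp 2 (X × Y) | ‖p.fst - a‖ < r ∧ ‖p.snd - b‖ < r} := by
      have h1 : Continuous fun p : WithLp 2 (X × Y) => ‖p.fst - a‖ := by fun_prop
      have h2 : Continuous fun p : WithLp 2 (X × Y) => ‖p.snd - b‖ := by fun_prop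
      exact (isOpen_lt h1 continuous_const).inter (isOpen_lt h2 continuous_const)
    have hev : ∀ᶠ p in 𝓝[gph Φ] (pair x y), ‖p.fst - a‖ < r ∧ ‖p.snd - b‖ < r :=
      nhdsWithin_le_nhds (hopen.mem_nhds ⟨hxe.trans_le her, hye.trans_le her⟩)
    filter_upwards [hev, self_mem_nhdsWithin] with p hp hpg
    obtain ⟨w, z⟩ := p
    change inner ℝ _ (pair w z - pair x y) ≤ _ * ‖pair w z - pair x y‖ ^ 2
    have h1 := hopt (x', w, z) ⟨hx'K, by
      simp only [Metric.mem_closedBall, Prod.dist_eq, max_le_iff]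
      simp only [dist_eq_norm]
      exact ⟨hp.1.le, hp.2.le⟩, hpg⟩
    simp only at h1
    rw [norm_sub_rev x' x, norm_sub_rev x' w, norm_sq_expand w x x', norm_sq_expand w x xb,
      norm_sq_expand w x a, norm_sq_expand z y yb, norm_sq_expand z y b] at h1
    rw [inner_pair_sub, norm_pair_sub_sq]
    simp only [inner_neg_left, inner_add_left, inner_smul_left, conj_trivial]
    nlinarith [mul_nonneg hk.le (sq_nonneg ‖w - x‖), mul_nonneg hn.le (sq_nonneg ‖z - y‖),
      sq_nonneg ‖z - y‖]
  refine ⟨x, x', (2 * n) • (x - x'),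
    -((2 * n) • (x - x') + (2 : ℝ) • (x - xb) + (2 : ℝ) • (x - a)), y,
    (2 * k) • (y - yb) + (2 : ℝ) • (y - b), hxe.trans_le heε', hx'e.trans_le heε',
    hye.trans_le heε', ?_, ?_, hξ, hxs⟩
  · have : (2 * k) • (y - yb) + (2 : ℝ) • (y - b) - (2 * k) • (b - yb)
        = (2 * k + 2) • (y - b) := by module
    rw [this, norm_smul_of_nonneg (by positivity)]
    nlinarith
  · have : (2 * n) • (x - x') + -((2 * n) • (x - x') + (2 : ℝ) • (x - xb) + (2 : ℝ) • (x - a))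
        + (2 : ℝ) • (a - xb) = -((4 : ℝ) • (x - a)) := by module
    rw [this, norm_neg, norm_smul_of_nonneg (by positivity)]
    nlinarith

end VarAnalysis

/-! ### Passage to the limit and approximate multipliers -/

namespace VarAnalysis

lemma exists_tendsto_subseq_of_not_tendsto_norm {E : Type*} [NormedAddCommGroup E] [ProperSpace E]
    {z : ℕ → E} (h : ¬ Tendsto (fun n => ‖z n‖) atTop atTop) :
    ∃ a, ∃ s : ℕ → ℕ, StrictMono s ∧ Tendsto (z ∘ s) atTop (𝓝 a) := by
  rw [tendsto_atTop] at h
  push Not at h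
  obtain ⟨R, hR⟩ := h
  obtain ⟨a, -, s, hs, ha⟩ := tendsto_subseq_of_frequently_bounded
    (Metric.isBounded_closedBall (x := (0 : E)) (r := R)) (x := z)
    (hR.mono fun n hn => by simpa using hn.le)
  exact ⟨a, s, hs, ha⟩

lemma tendsto_of_norm_sub_lt_min {E : Type*} [NormedAddCommGroup E] {f : ℕ → E} {a : E} {σ : ℝ}
    (h : ∀ n, ‖f n - a‖ < min σ (1 / ((n : ℝ) + 1))) : Tendsto f atTop (𝓝 a) := by
  rw [tendsto_iff_norm_sub_tendsto_zero]
  exact squeeze_zero (fun _ => norm_nonneg _) (fun n => (h n).le.trans (min_le_right _ _))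
    tendsto_one_div_add_atTop_nhds_zero_nat

variable {X Y : Type*} [NormedAddCommGroup X] [InnerProductSpace ℝ X]
  [NormedAddCommGroup Y] [InnerProductSpace ℝ Y]

lemma tendsto_pair {ι : Type*} {l : Filter ι} {x : ι → X} {y : ι → Y} {a : X} {b : Y}
    (hx : Tendsto x l (𝓝 a)) (hy : Tendsto y l (𝓝 b)) :
    Tendsto (fun i => pair (x i) (y i)) l (𝓝 (pair a b)) :=
  ((WithLp.prod_continuous_toLp 2 X Y).tendsto _).comp (hx.prodMk_nhds hy)

lemma mem_limitingSubdiff_of_tendsto {φ : X → ℝ} (hφ : Continuous φ) {xb ξ₀ : X} {x ξ : ℕ → X}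
    (hx : Tendsto x atTop (𝓝 xb)) (hξ : Tendsto ξ atTop (𝓝 ξ₀))
    (hmem : ∀ n, ξ n ∈ regularSubdiff φ (x n)) : ξ₀ ∈ limitingSubdiff φ xb :=
  ⟨le_refl (φ xb), fun n => pair (x n) (φ (x n)), fun n => pair (ξ n) (-1),
    fun n => le_refl (φ (x n)), tendsto_pair hx ((hφ.tendsto xb).comp hx),
    tendsto_pair hξ tendsto_const_nhds, hmem⟩

lemma isMStationary_of_tendsto {φ : X → ℝ} (hφ : Continuous φ) {Φ : X → Set Y} {xb ξ₀ : X}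
    {yb lam₀ : Y} (hfeas : xb ∈ invMap Φ yb) {x x' ξ xs : ℕ → X} {y lam : ℕ → Y}
    (hx : Tendsto x atTop (𝓝 xb)) (hx' : Tendsto x' atTop (𝓝 xb)) (hy : Tendsto y atTop (𝓝 yb))
    (hξ : Tendsto ξ atTop (𝓝 ξ₀)) (hxs : Tendsto xs atTop (𝓝 (-ξ₀)))
    (hlam : Tendsto lam atTop (𝓝 lam₀)) (hmem : ∀ n, ξ n ∈ regularSubdiff φ (x' n))
    (hco : ∀ n, xs n ∈ regularCoderivative Φ (x n) (y n) (lam n)) : IsMStationary φ Φ xb yb := by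
  refine ⟨hfeas, lam₀, Set.mem_add.2 ⟨ξ₀, mem_limitingSubdiff_of_tendsto hφ hx' hξ hmem, -ξ₀, ?_,
    add_neg_cancel ξ₀⟩⟩
  exact ⟨hfeas, fun n => pair (x n) (y n), fun n => pair (xs n) (-lam n), fun n => (hco n).1,
    tendsto_pair hx hy, tendsto_pair hxs hlam.neg, hco⟩

variable [FiniteDimensional ℝ X] [FiniteDimensional ℝ Y]

/-- At `(xb, yb)` the penalty gradient `2k(yb - yb)` vanishes, so the fuzzy multipliers tend to
zero, while the Lipschitz bound makes the subgradients converge along a subsequence. -/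
lemma isMStationary_of_penalized_local_min {φ : X → ℝ} (hφ : Continuous φ) {Φ : X → Set Y}
    (hΦ : IsClosed (gph Φ)) {xb : X} {yb : Y} (hfeas : xb ∈ invMap Φ yb) {k r σ : ℝ} (hk : 0 < k)
    (hr : 0 < r) (hσ : 0 < σ) {L : NNReal} (hL : LipschitzOnWith L φ (Metric.ball xb σ))
    (hmin : ∀ x y, y ∈ Φ x → ‖x - xb‖ ≤ r → ‖y - yb‖ ≤ r →
      φ xb + ‖xb - xb‖ ^ 2 + k * ‖yb - yb‖ ^ 2 ≤ φ x + ‖x - xb‖ ^ 2 + k * ‖y - yb‖ ^ 2) :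
    IsMStationary φ Φ xb yb := by
  have : ProperSpace X := FiniteDimensional.proper_real X
  have hfuzzy := fun n : ℕ => exists_fuzzy_multipliers hφ hΦ hk hr hfeas hmin
    (ε := min σ (1 / ((n : ℝ) + 1))) (by positivity)
  choose x x' ξ xs y lam hx hx' hy hlam hη hξ hxs using hfuzzy
  simp only [sub_self, smul_zero, add_zero] at hη hlam
  have hξL : ∀ n, ‖ξ n‖ ≤ L := fun n => norm_le_of_mem_regularSubdiff
    (Metric.isOpen_ball.mem_nhds (by
      rw [Metric.mem_ball, dist_eq_norm]; exact (hx' n).trans_le (min_le_left _ _))) hL (hξ n)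
  obtain ⟨ξ₀, -, s, hs, hξ₀⟩ := tendsto_subseq_of_bounded
    (Metric.isBounded_closedBall (x := (0 : X)) (r := L)) (x := ξ) (fun n => by simpa using hξL n)
  have hs' := hs.tendsto_atTop
  have hxs₀ : Tendsto (xs ∘ s) atTop (𝓝 (-ξ₀)) := by
    have h1 := (tendsto_of_norm_sub_lt_min (f := fun n => ξ n + xs n) (a := 0)
      (by simpa only [sub_zero] using hη)).comp hs'
    have h2 := h1.sub hξ₀
    rw [zero_sub] at h2
    refine h2.congr fun n => ?_
    simp
  exact isMStationary_of_tendsto hφ hfeas ((tendsto_of_norm_sub_lt_min hx).comp hs') ((tendsto_of_norm_sub_lt_min hx').comp hs')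
    ((tendsto_of_norm_sub_lt_min hy).comp hs') hξ₀ hxs₀
    ((tendsto_of_norm_sub_lt_min (a := (0 : Y)) (by simpa only [sub_zero] using hlam)).comp hs')
    (fun n => hξ (s n)) (fun n => hxs (s n))

/-- Approximate multipliers up to a tolerance `δ`, unless `xb` is M-stationary. -/
lemma isMStationary_or_exists_approx_multipliers {φ : X → ℝ} (hφ : Continuous φ) {Φ : X → Set Y}
    (hΦ : IsClosed (gph Φ)) {xb : X} {yb : Y} (hfeas : xb ∈ invMap Φ yb)
    (hmin : IsLocalMinOn φ (invMap Φ yb) xb) {L : NNReal} {N : Set X} (hN : N ∈ 𝓝 xb)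
    (hL : LipschitzOnWith L φ N) {δ : ℝ} (hδ : 0 < δ) :
    IsMStationary φ Φ xb yb ∨
    ∃ (x x' ξ xs : X) (y lam : Y), (x ∉ invMap Φ yb ∧ x' ∉ invMap Φ yb ∧ y ≠ yb ∧ lam ≠ 0) ∧
      ‖x - xb‖ ≤ δ ∧ ‖x' - xb‖ ≤ δ ∧ ‖y - yb‖ ≤ δ ∧ ‖x' - x‖ ≤ δ * ‖x - xb‖ ∧
      φ x - φ xb ≤ δ * ‖x - xb‖ ∧
      ‖lam‖ * ‖y - yb‖ ≤ 16 * L * Metric.infDist x (invMap Φ yb) ∧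
      ‖‖y - yb‖⁻¹ • (y - yb) - ‖lam‖⁻¹ • lam‖ ≤ δ ∧
      ξ ∈ regularSubdiff φ x' ∧ xs ∈ regularCoderivative Φ x y lam ∧ ‖ξ‖ ≤ L ∧
      ‖ξ + xs‖ ≤ δ := by
  have : ProperSpace X := FiniteDimensional.proper_real X
  obtain ⟨σ, hσ, hball⟩ := Metric.mem_nhds_iff.1
    (inter_mem hN (mem_nhdsWithin_iff_eventually.1 hmin))
  have hLσ : LipschitzOnWith L φ (Metric.ball xb σ) := hL.mono fun z hz => (hball hz).1
  have hminσ : ∀ z, ‖z - xb‖ < σ → z ∈ invMap Φ yb → φ xb ≤ φ z := fun z hz hzI =>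
    (hball (by rwa [Metric.mem_ball, dist_eq_norm])).2 hzI
  have hlip : ∀ z w, ‖z - xb‖ < σ → ‖w - xb‖ < σ → φ z - φ w ≤ L * ‖z - w‖ := fun z w hz hw =>
    (le_abs_self _).trans (hLσ.norm_sub_le (by rwa [Metric.mem_ball, dist_eq_norm])
      (by rwa [Metric.mem_ball, dist_eq_norm]))
  obtain ⟨k, hk, a, b, r, hr, hab, ha, hb, hval, hloc⟩ :=
    exists_penalized_local_min hφ hΦ hfeas hmin (ρ := min (σ / 4) (δ / 4)) (by positivity)
  obtain ⟨haσ, haδ⟩ := lt_min_iff.1 ha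
  obtain ⟨-, hbδ⟩ := lt_min_iff.1 hb
  -- If `a` is feasible, then `φ xb ≤ φ a`, and the value bound forces `(a, b) = (xb, yb)`.
  by_cases haI : a ∈ invMap Φ yb
  · left
    have h1 := hminσ a (by linarith) haI
    have h2 := mul_nonneg hk.le (sq_nonneg ‖b - yb‖)
    have h3 : ‖a - xb‖ ^ 2 = 0 := by nlinarith [sq_nonneg ‖a - xb‖]
    have h4 : k * ‖b - yb‖ ^ 2 = 0 := by nlinarith [sq_nonneg ‖a - xb‖]
    have h3 : a = xb := by simpa [sub_eq_zero] using h3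
    have h4 : b = yb := by simpa [sub_eq_zero, hk.ne'] using h4
    subst h3 h4
    exact isMStationary_of_penalized_local_min hφ hΦ hfeas hk hr hσ hLσ hloc
  right
  have hIcl := isClosed_invMap hΦ yb
  have hIne : (invMap Φ yb).Nonempty := ⟨xb, hfeas⟩
  set D := Metric.infDist a (invMap Φ yb) with hD
  have hD0 : 0 < D := (hIcl.notMem_iff_infDist_pos hIne).1 haI
  have hDa : D ≤ ‖a - xb‖ := by
    rw [← dist_eq_norm]; exact Metric.infDist_le_dist_of_mem hfeas
  have hbne : b - yb ≠ 0 := fun h => haI (by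
    rw [sub_eq_zero] at h; subst h; exact hab)
  have hb0 := norm_pos_iff.2 hbne
  set m : Y := (2 * k) • (b - yb) with hm
  have hmne : m ≠ 0 := smul_ne_zero (by positivity) hbne
  have hm0 := norm_pos_iff.2 hmne
  -- Compare with the projection `p` of `a` onto the feasible set; `ρ ≤ σ / 4` keeps `p` where `xb`
  -- is optimal and `φ` is `L`-Lipschitz.
  have hmb : ‖m‖ * ‖b - yb‖ ≤ 2 * L * D := by
    obtain ⟨p, hp, hpD⟩ := hIcl.exists_infDist_eq_dist hIne a
    rw [← hD, dist_eq_norm] at hpD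
    have hpσ : ‖p - xb‖ < σ := by
      have := norm_sub_le_norm_sub_add_norm_sub p a xb
      rw [norm_sub_rev p a] at this
      linarith
    have h1 := hminσ p hpσ hp
    have h2 := hlip p a hpσ (by linarith)
    rw [norm_sub_rev p a, ← hpD] at h2
    rw [hm, norm_smul_of_nonneg (by positivity)]
    linarith [sq_nonneg ‖a - xb‖]
  -- A relative tolerance: errors below `τ` times `D`, `‖b - yb‖` and `‖m‖` keep `x`, `x'`
  -- infeasible and `y - yb`, `lam` nonzero. The factor `1 + L` controls the change of `φ` as well.
  set τ : ℝ := min (δ / 8) (1 / 2) / (1 + L) with hτ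
  have hτ0 : 0 < τ := by positivity
  have hτL : τ * (1 + L) = min (δ / 8) (1 / 2) := by
    rw [hτ, div_mul_cancel₀]; positivity
  have hL0 : (0 : ℝ) ≤ L := L.2
  have hτδ : τ * (1 + L) ≤ δ / 8 := hτL ▸ min_le_left _ _
  have hτδ' : τ ≤ δ / 8 := by nlinarith
  have hτ2 : τ ≤ 1 / 2 := by
    have : τ * (1 + L) ≤ 1 / 2 := hτL ▸ min_le_right _ _
    nlinarith
  obtain ⟨x, x', ξ, xs, y, lam, hx, hx', hy, hlam, hη, hξ, hxs⟩ :=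
    exists_fuzzy_multipliers hφ hΦ hk hr hab hloc
      (ε := min (min (τ * D) (τ * ‖b - yb‖)) (min (τ * ‖m‖) (τ * min 1 σ))) (by positivity)
  simp only [lt_min_iff] at hx hx' hy hlam hη
  rw [← hm] at hlam
  have hστ : τ * min 1 σ ≤ σ / 2 := by
    have : min 1 σ ≤ σ := min_le_right _ _
    linarith [mul_le_mul_of_nonneg_right hτ2 (lt_min one_pos hσ).le]
  have h1τ : τ * min 1 σ ≤ τ := by
    linarith [mul_le_mul_of_nonneg_left (min_le_left 1 σ) hτ0.le]
  have hτD : τ * D ≤ D / 2 := by linarith [mul_le_mul_of_nonneg_right hτ2 hD0.le]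
  have hτb : τ * ‖b - yb‖ ≤ ‖b - yb‖ / 2 := by linarith [mul_le_mul_of_nonneg_right hτ2 hb0.le]
  have hτm : τ * ‖m‖ ≤ ‖m‖ / 2 := by linarith [mul_le_mul_of_nonneg_right hτ2 hm0.le]
  have hnear : ∀ z, ‖z - a‖ < τ * D → z ∉ invMap Φ yb := fun z hz hzI => by
    have : D ≤ ‖z - a‖ := by
      rw [norm_sub_rev, ← dist_eq_norm]; exact Metric.infDist_le_dist_of_mem hzI
    linarith
  have hDx : D ≤ 2 * Metric.infDist x (invMap Φ yb) := by
    have h1 := Metric.infDist_le_infDist_add_dist (s := invMap Φ yb) (x := a) (y := x)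
    rw [dist_comm, dist_eq_norm, ← hD] at h1
    linarith [hx.1.1]
  have hxt : Metric.infDist x (invMap Φ yb) ≤ ‖x - xb‖ := by
    rw [← dist_eq_norm]; exact Metric.infDist_le_dist_of_mem hfeas
  have hxσ : ‖x - xb‖ < σ := by
    linarith [norm_sub_le_norm_sub_add_norm_sub x a xb]
  have hx'σ : ‖x' - xb‖ < σ := by
    linarith [norm_sub_le_norm_sub_add_norm_sub x' a xb]
  have hy2 : ‖y - yb‖ ≤ 2 * ‖b - yb‖ := by
    linarith [norm_sub_le_norm_sub_add_norm_sub y b yb, hy.1.2]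
  have hlam2 : ‖lam‖ ≤ 2 * ‖m‖ := by
    have := norm_add_le m (lam - m)
    rw [add_sub_cancel] at this
    linarith [hlam.2.1]
  refine ⟨x, x', ξ, xs, y, lam, ⟨hnear x hx.1.1, hnear x' hx'.1.1, ?_, ?_⟩, ?_, ?_, ?_, ?_, ?_, ?_,
    ?_, hξ, hxs, ?_, ?_⟩
  · rintro rfl
    rw [norm_sub_rev] at hy
    linarith [hy.1.2]
  · rintro rfl
    rw [zero_sub, norm_neg] at hlam
    linarith [hlam.2.1]
  · linarith [norm_sub_le_norm_sub_add_norm_sub x a xb]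
  · linarith [norm_sub_le_norm_sub_add_norm_sub x' a xb]
  · linarith [norm_sub_le_norm_sub_add_norm_sub y b yb]
  · have h1 := norm_sub_le_norm_sub_add_norm_sub x' a x
    rw [norm_sub_rev a x] at h1
    have h2 : τ * D ≤ δ / 8 * (2 * ‖x - xb‖) :=
      mul_le_mul hτδ' (by linarith) hD0.le (by positivity)
    have h3 := mul_nonneg hδ.le (norm_nonneg (x - xb))
    linarith [hx.1.1, hx'.1.1]
  · have h1 := hlip x a hxσ (by linarith)
    have h2 := mul_nonneg hk.le (sq_nonneg ‖b - yb‖)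
    have h3 : (L : ℝ) * ‖x - a‖ ≤ L * (τ * D) := mul_le_mul_of_nonneg_left hx.1.1.le hL0
    have h4 : L * τ ≤ δ / 8 := by linarith
    have h5 : L * τ * D ≤ δ / 8 * (2 * ‖x - xb‖) :=
      mul_le_mul h4 (by linarith) hD0.le (by positivity)
    linarith [sq_nonneg ‖a - xb‖, mul_nonneg hδ.le (norm_nonneg (x - xb))]
  -- The constant 16 is the 2 from `hmb` times a factor 2 for each passage from `m`, `b`, `a` to
  -- `lam`, `y`, `x`.
  · calc ‖lam‖ * ‖y - yb‖ ≤ (2 * ‖m‖) * (2 * ‖b - yb‖) :=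
          mul_le_mul hlam2 hy2 (norm_nonneg _) (by positivity)
      _ = 4 * (‖m‖ * ‖b - yb‖) := by ring
      _ ≤ 4 * (2 * L * D) := by linarith
      _ ≤ 4 * (2 * L * (2 * Metric.infDist x (invMap Φ yb))) := by gcongr
      _ = _ := by ring
  -- `m` is a positive multiple of `b - yb`, so both have the same unit vector.
  · have h1 := norm_normalize_sub_le (y - yb) hbne
    have h2 := norm_normalize_sub_le lam hmne
    have h3 : ‖m‖⁻¹ • m = ‖b - yb‖⁻¹ • (b - yb) := by
      rw [hm, norm_smul_of_nonneg (by positivity), smul_smul]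
      congr 1
      field_simp
    rw [h3] at h2
    rw [sub_sub_sub_cancel_right] at h1
    have h4 : 2 * ‖y - b‖ / ‖b - yb‖ ≤ 2 * τ := by
      rw [div_le_iff₀ hb0]; linarith [hy.1.2]
    have h5 : 2 * ‖lam - m‖ / ‖m‖ ≤ 2 * τ := by
      rw [div_le_iff₀ hm0]; linarith [hlam.2.1]
    have h6 := norm_sub_le_norm_sub_add_norm_sub (‖y - yb‖⁻¹ • (y - yb))
      (‖b - yb‖⁻¹ • (b - yb)) (‖lam‖⁻¹ • lam)
    rw [norm_sub_rev (‖b - yb‖⁻¹ • (b - yb))] at h6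
    linarith
  · exact norm_le_of_mem_regularSubdiff
      (Metric.isOpen_ball.mem_nhds (by rwa [Metric.mem_ball, dist_eq_norm])) hLσ hξ
  · have h1 := norm_sub_le (ξ + xs + (2 : ℝ) • (a - xb)) ((2 : ℝ) • (a - xb))
    rw [add_sub_cancel_right, norm_smul_of_nonneg (by norm_num)] at h1
    linarith [hη.2.2]

end VarAnalysis

/-! ### Limits of approximate multiplier sequences -/

namespace VarAnalysis

variable {X Y : Type*} [NormedAddCommGroup X] [InnerProductSpace ℝ X]
  [NormedAddCommGroup Y] [InnerProductSpace ℝ Y]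

/-- Sequences of approximate multipliers along a direction `u`, with limiting subgradient `ξ₀`. -/
structure IsApproxMultiplierSeq (φ : X → ℝ) (Φ : X → Set Y) (xb : X) (yb : Y) (C : ℝ) (u ξ₀ : X)
    (x x' ξ xs : ℕ → X) (y lam : ℕ → Y) : Prop where
  notMem (n : ℕ) : x n ∉ invMap Φ yb ∧ x' n ∉ invMap Φ yb ∧ y n ≠ yb ∧ lam n ≠ 0
  tendsto_x : Tendsto x atTop (𝓝 xb)
  tendsto_x' : Tendsto x' atTop (𝓝 xb)
  tendsto_y : Tendsto y atTop (𝓝 yb)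
  dir : Tendsto (fun n => ‖x n - xb‖⁻¹ • (x n - xb)) atTop (𝓝 u)
  dir' : Tendsto (fun n => ‖x' n - xb‖⁻¹ • (x' n - xb)) atTop (𝓝 u)
  value_le : ∃ c : ℕ → ℝ, Tendsto c atTop (𝓝 0) ∧ ∀ n, φ (x n) - φ xb ≤ c n * ‖x n - xb‖
  norm_mul_le (n : ℕ) : ‖lam n‖ * ‖y n - yb‖ ≤ C * Metric.infDist (x n) (invMap Φ yb)
  align : Tendsto (fun n => ‖y n - yb‖⁻¹ • (y n - yb) - ‖lam n‖⁻¹ • lam n) atTop (𝓝 0)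
  subgradient (n : ℕ) : ξ n ∈ regularSubdiff φ (x' n)
  coderivative (n : ℕ) : xs n ∈ regularCoderivative Φ (x n) (y n) (lam n)
  tendsto_subgradient : Tendsto ξ atTop (𝓝 ξ₀)
  tendsto_coderivative : Tendsto xs atTop (𝓝 (-ξ₀))

namespace IsApproxMultiplierSeq

variable {φ : X → ℝ} {Φ : X → Set Y} {xb : X} {yb : Y} {C : ℝ} {u ξ₀ : X}
  {x x' ξ xs : ℕ → X} {y lam : ℕ → Y}

lemma comp (h : IsApproxMultiplierSeq φ Φ xb yb C u ξ₀ x x' ξ xs y lam) {s : ℕ → ℕ}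
    (hs : Tendsto s atTop atTop) :
    IsApproxMultiplierSeq φ Φ xb yb C u ξ₀ (x ∘ s) (x' ∘ s) (ξ ∘ s) (xs ∘ s) (y ∘ s) (lam ∘ s) where
  notMem n := h.notMem (s n)
  tendsto_x := h.tendsto_x.comp hs
  tendsto_x' := h.tendsto_x'.comp hs
  tendsto_y := h.tendsto_y.comp hs
  dir := h.dir.comp hs
  dir' := h.dir'.comp hs
  value_le := let ⟨c, hc, hle⟩ := h.value_le; ⟨c ∘ s, hc.comp hs, fun n => hle (s n)⟩
  norm_mul_le n := h.norm_mul_le (s n)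
  align := h.align.comp hs
  subgradient n := h.subgradient (s n)
  coderivative n := h.coderivative (s n)
  tendsto_subgradient := h.tendsto_subgradient.comp hs
  tendsto_coderivative := h.tendsto_coderivative.comp hs

variable (h : IsApproxMultiplierSeq φ Φ xb yb C u ξ₀ x x' ξ xs y lam)
include h

lemma norm_sub_pos (hfeas : xb ∈ invMap Φ yb) (n : ℕ) : 0 < ‖x n - xb‖ :=
  norm_pos_iff.2 fun h0 => (h.notMem n).1 (by rwa [sub_eq_zero.1 h0])

lemma norm_mul_div_le (hC : 0 ≤ C) (hfeas : xb ∈ invMap Φ yb) (n : ℕ) :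
    ‖lam n‖ * (‖y n - yb‖ / ‖x n - xb‖) ≤ C := by
  have hx := h.norm_sub_pos hfeas n
  rw [← mul_div_assoc, div_le_iff₀ hx]
  refine (h.norm_mul_le n).trans (mul_le_mul_of_nonneg_left ?_ hC)
  rw [← dist_eq_norm]
  exact Metric.infDist_le_dist_of_mem hfeas

lemma posNull (hfeas : xb ∈ invMap Φ yb) : PosNull fun n => ‖x n - xb‖ :=
  ⟨h.norm_sub_pos hfeas, tendsto_iff_norm_sub_tendsto_zero.1 h.tendsto_x⟩

lemma norm_dir (hfeas : xb ∈ invMap Φ yb) (n : ℕ) : ‖‖x n - xb‖⁻¹ • (x n - xb)‖ = 1 := by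
  rw [norm_smul, norm_inv, norm_norm, inv_mul_cancel₀ (h.norm_sub_pos hfeas n).ne']

lemma add_smul_dir (hfeas : xb ∈ invMap Φ yb) (n : ℕ) :
    xb + ‖x n - xb‖ • (‖x n - xb‖⁻¹ • (x n - xb)) = x n := by
  rw [smul_inv_smul₀ (h.norm_sub_pos hfeas n).ne', add_sub_cancel]

lemma add_smul_inv_smul (hfeas : xb ∈ invMap Φ yb) (n : ℕ) :
    yb + ‖x n - xb‖ • (‖x n - xb‖⁻¹ • (y n - yb)) = y n := by
  rw [smul_inv_smul₀ (h.norm_sub_pos hfeas n).ne', add_sub_cancel]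

lemma norm_eq_one (hfeas : xb ∈ invMap Φ yb) : ‖u‖ = 1 :=
  tendsto_nhds_unique h.dir.norm (by simp only [h.norm_dir hfeas]; exact tendsto_const_nhds)

/-- The quotient is at most `C / ‖lam n‖`. This gives both criticality of `u` and its membership in
the kernel of the graphical derivative. -/
lemma tendsto_inv_smul (hC : 0 ≤ C) (hfeas : xb ∈ invMap Φ yb)
    (hlam : Tendsto (fun n => ‖lam n‖) atTop atTop) :
    Tendsto (fun n => ‖x n - xb‖⁻¹ • (y n - yb)) atTop (𝓝 0) := by
  refine squeeze_zero_norm (a := fun n => C / ‖lam n‖) (fun n => ?_)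
    (Tendsto.const_div_atTop hlam C)
  rw [norm_smul, norm_inv, norm_norm, le_div_iff₀ (norm_pos_iff.2 (h.notMem n).2.2.2),
    inv_mul_eq_div, mul_comm]
  exact h.norm_mul_div_le hC hfeas n

lemma isCriticalDirection (hC : 0 ≤ C) (hfeas : xb ∈ invMap Φ yb)
    (hlam : Tendsto (fun n => ‖lam n‖) atTop atTop) : IsCriticalDirection φ Φ xb yb u := by
  refine ⟨by simpa using h.norm_eq_one hfeas, _, _, _, h.dir, h.tendsto_inv_smul hC hfeas hlam,
    h.posNull hfeas, fun n => ?_, ?_⟩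
  · rw [h.add_smul_dir hfeas, h.add_smul_inv_smul hfeas]
    exact (h.coderivative n).1
  · obtain ⟨c, hc, hle⟩ := h.value_le
    have hc' : Tendsto (fun n => (c n : EReal)) atTop (𝓝 0) :=
      (continuous_coe_real_ereal.tendsto 0).comp hc
    refine (limsup_le_limsup (Eventually.of_forall fun n => ?_)).trans hc'.limsup_eq.le
    simp only [h.add_smul_dir hfeas]
    rw [EReal.coe_le_coe_iff, div_le_iff₀ (h.norm_sub_pos hfeas n)]
    exact hle n

lemma mem_kerMap (hC : 0 ≤ C) (hfeas : xb ∈ invMap Φ yb)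
    (hlam : Tendsto (fun n => ‖lam n‖) atTop atTop) :
    u ∈ kerMap (graphicalDerivative Φ xb yb) := by
  refine ⟨hfeas, _, _, tendsto_pair h.dir (h.tendsto_inv_smul hC hfeas hlam), h.posNull hfeas,
    fun n => ?_⟩
  have : pair xb yb + ‖x n - xb‖ • pair (‖x n - xb‖⁻¹ • (x n - xb)) (‖x n - xb‖⁻¹ • (y n - yb))
      = pair (x n) (y n) := by
    rw [pair, pair, ← WithLp.toLp_smul, ← WithLp.toLp_add, Prod.smul_mk, Prod.mk_add_mk,
      h.add_smul_dir hfeas, h.add_smul_inv_smul hfeas]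
  rw [this]
  exact (h.coderivative n).1

/-- Subregularity bounds the distance in `norm_mul_le` by a multiple of `‖y n - yb‖`, which then
cancels. -/
lemma norm_rpow_mul_le_of_subregular {γ : ℝ} (hC : 0 ≤ C) (hfeas : xb ∈ invMap Φ yb)
    (hsub : MetricallyPseudoSubregular γ Φ xb yb u) :
    ∃ R, ∀ᶠ n in atTop, ‖x n - xb‖ ^ (γ - 1) * ‖lam n‖ ≤ R := by
  obtain ⟨ε, δ, κ, hε, hδ, hκ, hsub⟩ := hsub
  refine ⟨C * κ, ?_⟩
  have h1 := (h.posNull hfeas).2.eventually_lt_const hε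
  have h2 := (tendsto_iff_norm_sub_tendsto_zero.1 h.dir).eventually_lt_const hδ
  filter_upwards [h1, h2] with n hn1 hn2
  have ht := h.norm_sub_pos hfeas n
  have hmem : x n - xb ∈ dirNhd ε δ u := by
    refine ⟨?_, hn1.le⟩
    rw [h.norm_eq_one hfeas, one_smul, mul_one]
    have : ‖x n - xb‖ • u - (x n - xb)
        = -(‖x n - xb‖ • (‖x n - xb‖⁻¹ • (x n - xb) - u)) := by
      rw [smul_sub, smul_inv_smul₀ ht.ne', neg_sub]
    rw [this, norm_neg, norm_smul, norm_norm, mul_comm]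
    exact mul_le_mul_of_nonneg_right hn2.le ht.le
  have hyn : y n ∈ Φ (x n) := (h.coderivative n).1
  have h3 := (hsub (x n) hmem).trans (mul_le_mul_right (Metric.infEDist_le_edist_of_mem hyn) _)
  have hpow : 0 ≤ ‖x n - xb‖ ^ (γ - 1) := by positivity
  have h4 : ‖x n - xb‖ ^ (γ - 1) * Metric.infDist (x n) (invMap Φ yb) ≤ κ * ‖y n - yb‖ := by
    have h5 := ENNReal.toReal_mono
      (ENNReal.mul_ne_top ENNReal.ofReal_ne_top (edist_ne_top _ _)) h3
    rw [ENNReal.toReal_mul, ENNReal.toReal_mul, ENNReal.toReal_ofReal hpow,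
      ENNReal.toReal_ofReal hκ.le, ← dist_edist, dist_comm, dist_eq_norm] at h5
    exact h5
  have hy : 0 < ‖y n - yb‖ := norm_pos_iff.2 (sub_ne_zero.2 (h.notMem n).2.2.1)
  refine le_of_mul_le_mul_right ?_ hy
  calc ‖x n - xb‖ ^ (γ - 1) * ‖lam n‖ * ‖y n - yb‖
      = ‖x n - xb‖ ^ (γ - 1) * (‖lam n‖ * ‖y n - yb‖) := by ring
    _ ≤ ‖x n - xb‖ ^ (γ - 1) * (C * Metric.infDist (x n) (invMap Φ yb)) :=
        mul_le_mul_of_nonneg_left (h.norm_mul_le n) hpow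
    _ = C * (‖x n - xb‖ ^ (γ - 1) * Metric.infDist (x n) (invMap Φ yb)) := by ring
    _ ≤ C * (κ * ‖y n - yb‖) := mul_le_mul_of_nonneg_left h4 hC
    _ = _ := by ring

lemma rpow_eq (γ : ℝ) (hfeas : xb ∈ invMap Φ yb) (n : ℕ) :
    ‖x n - xb‖ ^ γ = ‖x n - xb‖ ^ (γ - 1) * ‖x n - xb‖ := by
  rw [← Real.rpow_add_one (h.norm_sub_pos hfeas n).ne', sub_add_cancel]

/-- The exponents `γ - 1` and `-γ` add up to `-1`, so the bound does not depend on `γ`. -/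
lemma norm_scaled_mul_le (γ : ℝ) (hC : 0 ≤ C) (hfeas : xb ∈ invMap Φ yb) (n : ℕ) :
    ‖‖x n - xb‖ ^ (γ - 1) • lam n‖ * ‖(‖x n - xb‖ ^ γ)⁻¹ • (y n - yb)‖ ≤ C := by
  have ht := h.norm_sub_pos hfeas n
  have hp : 0 < ‖x n - xb‖ ^ (γ - 1) := by positivity
  refine le_of_eq_of_le ?_ (h.norm_mul_div_le hC hfeas n)
  rw [norm_smul_of_nonneg hp.le, norm_smul_of_nonneg (by positivity), h.rpow_eq γ hfeas]
  field_simp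

/-- Unit vectors at distance at most one have inner product at least one half. -/
lemma inner_nonneg_eventually : ∀ᶠ n in atTop, 0 ≤ inner ℝ (lam n) (y n - yb) := by
  have h1 : Tendsto (fun n => ‖‖y n - yb‖⁻¹ • (y n - yb) - ‖lam n‖⁻¹ • lam n‖) atTop (𝓝 0) := by
    simpa using h.align.norm
  filter_upwards [h1.eventually_lt_const one_pos] with n hn
  have hy : 0 < ‖y n - yb‖ := norm_pos_iff.2 (sub_ne_zero.2 (h.notMem n).2.2.1)
  have hl : 0 < ‖lam n‖ := norm_pos_iff.2 (h.notMem n).2.2.2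
  have h2 : ‖‖y n - yb‖⁻¹ • (y n - yb) - ‖lam n‖⁻¹ • lam n‖ ^ 2 ≤ 1 :=
    pow_le_one₀ (norm_nonneg _) hn.le
  rw [norm_sub_sq_real, norm_smul, norm_smul, norm_inv, norm_inv, norm_norm, norm_norm,
    inv_mul_cancel₀ hy.ne', inv_mul_cancel₀ hl.ne', inner_smul_left, inner_smul_right] at h2
  simp only [conj_trivial] at h2
  rw [real_inner_comm]
  have h3 : 0 ≤ ‖y n - yb‖⁻¹ * (‖lam n‖⁻¹ * inner ℝ (y n - yb) (lam n)) := by linarith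
  exact nonneg_of_mul_nonneg_right (nonneg_of_mul_nonneg_right h3 (by positivity))
    (by positivity)

lemma mem_gfrererPseudoCoderivative (γ : ℝ) (hC : 0 ≤ C) (hfeas : xb ∈ invMap Φ yb)
    (hlam : Tendsto (fun n => ‖lam n‖) atTop atTop)
    (hL : Tendsto (fun n => ‖x n - xb‖ ^ (γ - 1) • lam n) atTop (𝓝 0)) :
    -ξ₀ ∈ gfrererPseudoCoderivative γ Φ xb yb u 0 0 := by
  refine ⟨_, xs, _, _, _, h.dir, h.tendsto_inv_smul hC hfeas hlam, h.posNull hfeas,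
    h.tendsto_coderivative, hL, fun n => ?_⟩
  have hp : ‖x n - xb‖ ^ (γ - 1) ≠ 0 := (Real.rpow_pos_of_pos (h.norm_sub_pos hfeas n) _).ne'
  rw [h.norm_dir hfeas, mul_one, h.add_smul_dir hfeas, h.add_smul_inv_smul hfeas,
    inv_smul_smul₀ hp]
  exact h.coderivative n

lemma mem_pseudoCoderivative {γ : ℝ} {v l : Y} (hfeas : xb ∈ invMap Φ yb)
    (hv : Tendsto (fun n => (‖x n - xb‖ ^ γ)⁻¹ • (y n - yb)) atTop (𝓝 v))
    (hL : Tendsto (fun n => ‖x n - xb‖ ^ (γ - 1) • lam n) atTop (𝓝 l)) :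
    -ξ₀ ∈ pseudoCoderivative γ Φ xb yb u v l := by
  refine ⟨_, xs, _, _, _, h.dir, hv, h.posNull hfeas, h.tendsto_coderivative, hL, fun n => ?_⟩
  have hp : ‖x n - xb‖ ^ (γ - 1) ≠ 0 := (Real.rpow_pos_of_pos (h.norm_sub_pos hfeas n) _).ne'
  have hp' : ‖x n - xb‖ ^ γ ≠ 0 := (Real.rpow_pos_of_pos (h.norm_sub_pos hfeas n) _).ne'
  rw [h.norm_dir hfeas, mul_one, h.add_smul_dir hfeas, smul_inv_smul₀ hp', inv_smul_smul₀ hp,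
    add_sub_cancel]
  exact h.coderivative n

lemma inner_nonneg_of_tendsto {γ : ℝ} {v l : Y}
    (hv : Tendsto (fun n => (‖x n - xb‖ ^ γ)⁻¹ • (y n - yb)) atTop (𝓝 v))
    (hL : Tendsto (fun n => ‖x n - xb‖ ^ (γ - 1) • lam n) atTop (𝓝 l)) :
    0 ≤ inner ℝ l v := by
  refine ge_of_tendsto (hL.inner hv) ?_
  filter_upwards [h.inner_nonneg_eventually] with n hn
  rw [inner_smul_left, inner_smul_right]
  simp only [conj_trivial]
  positivity

lemma isApproxStationaryAlong [FiniteDimensional ℝ Y] {γ : ℝ} (hC : 0 ≤ C)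
    (hfeas : xb ∈ invMap Φ yb)
    (hL : Tendsto (fun n => ‖‖x n - xb‖ ^ (γ - 1) • lam n‖) atTop atTop) :
    IsApproxStationaryAlong γ φ Φ xb yb u := by
  have : ProperSpace Y := FiniteDimensional.proper_real Y
  -- The vectors `y_k^*` of (iv) are the scaled multipliers times `‖v_k^γ‖`, hence bounded by `C`.
  have hbd : ∀ n, ‖(‖y n - yb‖ / ‖x n - xb‖ ^ γ) • ‖x n - xb‖ ^ (γ - 1) • lam n‖ ≤ C := fun n => by
    refine le_of_eq_of_le ?_ (h.norm_scaled_mul_le γ hC hfeas n)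
    rw [norm_smul_of_nonneg (by positivity),
      norm_smul_of_nonneg (t := (‖x n - xb‖ ^ γ)⁻¹) (by positivity)]
    ring
  obtain ⟨yStar, -, s, hs, hys⟩ := tendsto_subseq_of_bounded
    (Metric.isBounded_closedBall (x := (0 : Y)) (r := C)) (fun n => by simpa using hbd n)
  have hs' := hs.tendsto_atTop
  have hg := h.comp hs'
  have hx0 := hg.norm_sub_pos hfeas
  have hy0 : ∀ n, ‖(y ∘ s) n - yb‖ ≠ 0 := fun n =>
    (norm_pos_iff.2 (sub_ne_zero.2 (hg.notMem n).2.2.1)).ne'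
  have hp : ∀ n, 0 < ‖(x ∘ s) n - xb‖ ^ (γ - 1) := fun n => Real.rpow_pos_of_pos (hx0 n) _
  have hp' : ∀ n, ‖(x ∘ s) n - xb‖ ^ γ ≠ 0 := fun n => (Real.rpow_pos_of_pos (hx0 n) _).ne'
  have hL' : Tendsto (fun n => ‖‖(x ∘ s) n - xb‖ ^ (γ - 1) • (lam ∘ s) n‖) atTop atTop :=
    hL.comp hs'
  refine ⟨x ∘ s, x' ∘ s, fun n => (ξ ∘ s) n + (xs ∘ s) n, y ∘ s, _,
    fun n => (‖(x ∘ s) n - xb‖ ^ γ)⁻¹ • ((y ∘ s) n - yb),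
    fun n => ‖(x ∘ s) n - xb‖ ^ (γ - 1) • (lam ∘ s) n, yStar,
    fun n => ⟨(hg.notMem n).1, (hg.notMem n).2.1, (hg.notMem n).2.2.1, ?_⟩, fun n => rfl,
    fun n => ?_, hg.tendsto_x, hg.tendsto_x', hg.tendsto_y, hg.dir, hg.dir', ?_, hys, hL', ?_, ?_,
    fun n => ?_⟩
  · exact smul_ne_zero (div_ne_zero (hy0 n) (hp' n))
      (smul_ne_zero (hp n).ne' (hg.notMem n).2.2.2)
  · change _ = (‖(x ∘ s) n - xb‖ ^ γ / ‖(y ∘ s) n - yb‖) •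
      ((‖(y ∘ s) n - yb‖ / ‖(x ∘ s) n - xb‖ ^ γ) • ‖(x ∘ s) n - xb‖ ^ (γ - 1) • (lam ∘ s) n)
    rw [smul_smul (_ / _), div_mul_div_cancel₀ (hy0 n), div_self (hp' n), one_smul]
  · refine squeeze_zero_norm (fun n => ?_) (Tendsto.const_div_atTop hL' C)
    rw [le_div_iff₀ (norm_pos_iff.2 (smul_ne_zero (hp n).ne' (hg.notMem n).2.2.2)), mul_comm]
    exact hg.norm_scaled_mul_le γ hC hfeas n
  · simpa using hg.tendsto_subgradient.add hg.tendsto_coderivative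
  · refine hg.align.congr fun n => ?_
    have := (hp n).ne'
    rw [norm_smul_of_nonneg (hp n).le, smul_smul, mul_inv, mul_right_comm,
      inv_mul_cancel₀ this, one_mul]
  · refine Set.add_mem_add (hg.subgradient n) ?_
    rw [inv_smul_smul₀ (hp n).ne']
    exact hg.coderivative n

/-- The classification of limits of approximate multipliers. -/
lemma stationary_cases [FiniteDimensional ℝ Y] (γ : ℝ) (hφ : Continuous φ) (hC : 0 ≤ C)
    (hfeas : xb ∈ invMap Φ yb) :
    IsMStationary φ Φ xb yb ∨
      (∃ u : X, IsCriticalDirection φ Φ xb yb u ∧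
        0 ∈ limitingSubdiff φ xb + gfrererPseudoCoderivative γ Φ xb yb u 0 0) ∨
      (∃ (u : X) (v lam : Y), IsCriticalDirection φ Φ xb yb u ∧ lam ≠ 0 ∧
        0 ≤ inner ℝ lam v ∧
        0 ∈ limitingSubdiff φ xb + pseudoCoderivative γ Φ xb yb u v lam) ∨
      (∃ u : X, IsCriticalDirection φ Φ xb yb u ∧ IsApproxStationaryAlong γ φ Φ xb yb u ∧
        u ∈ Metric.sphere (0 : X) 1 ∩ kerMap (graphicalDerivative Φ xb yb) ∧
        ¬ MetricallyPseudoSubregular γ Φ xb yb u) := by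
  have : ProperSpace Y := FiniteDimensional.proper_real Y
  have hξ₀ := mem_limitingSubdiff_of_tendsto hφ h.tendsto_x' h.tendsto_subgradient h.subgradient
  by_cases hlam : Tendsto (fun n => ‖lam n‖) atTop atTop
  swap
  · left
    obtain ⟨l, s, hs, hl⟩ := exists_tendsto_subseq_of_not_tendsto_norm hlam
    have hg := h.comp hs.tendsto_atTop
    exact isMStationary_of_tendsto hφ hfeas hg.tendsto_x hg.tendsto_x' hg.tendsto_y
      hg.tendsto_subgradient hg.tendsto_coderivative hl hg.subgradient hg.coderivative
  right
  have hcrit := h.isCriticalDirection hC hfeas hlam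
  by_cases hL : Tendsto (fun n => ‖‖x n - xb‖ ^ (γ - 1) • lam n‖) atTop atTop
  · refine Or.inr (Or.inr ⟨u, hcrit, h.isApproxStationaryAlong hC hfeas hL,
      ⟨hcrit.1, h.mem_kerMap hC hfeas hlam⟩, fun hsub => ?_⟩)
    obtain ⟨R, hR⟩ := h.norm_rpow_mul_le_of_subregular hC hfeas hsub
    obtain ⟨n, hn, hn'⟩ := (hR.and (hL.eventually_gt_atTop R)).exists
    rw [norm_smul_of_nonneg (by positivity)] at hn'
    exact hn'.not_ge hn
  obtain ⟨l, s, hs, hl⟩ := exists_tendsto_subseq_of_not_tendsto_norm hL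
  have hg := h.comp hs.tendsto_atTop
  rcases eq_or_ne l 0 with rfl | hl0
  · exact Or.inl ⟨u, hcrit, Set.mem_add.2 ⟨ξ₀, hξ₀, -ξ₀,
      hg.mem_gfrererPseudoCoderivative γ hC hfeas (hlam.comp hs.tendsto_atTop) hl,
      add_neg_cancel _⟩⟩
  -- Since `l ≠ 0`, divergence of the scaled values would make the product of norms exceed `C`.
  obtain ⟨v, s', hs', hv⟩ := exists_tendsto_subseq_of_not_tendsto_norm
    (z := fun n => (‖(x ∘ s) n - xb‖ ^ γ)⁻¹ • ((y ∘ s) n - yb)) (fun hv => by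
      obtain ⟨n, hn⟩ := ((hl.norm.pos_mul_atTop (norm_pos_iff.2 hl0) hv).eventually_gt_atTop C).exists
      exact hn.not_ge (hg.norm_scaled_mul_le γ hC hfeas n))
  have hk := hg.comp hs'.tendsto_atTop
  have hl' := hl.comp hs'.tendsto_atTop
  exact Or.inr (Or.inl ⟨u, v, l, hcrit, hl0, hk.inner_nonneg_of_tendsto hv hl',
    Set.mem_add.2 ⟨ξ₀, hξ₀, -ξ₀, hk.mem_pseudoCoderivative hfeas hv hl', add_neg_cancel _⟩⟩)

end IsApproxMultiplierSeq

/-! ### Existence of approximate multiplier sequences and the theorem -/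

lemma isMStationary_or_exists_isApproxMultiplierSeq [FiniteDimensional ℝ X]
    [FiniteDimensional ℝ Y] {φ : X → ℝ} (hφ : LocallyLipschitz φ) {Φ : X → Set Y}
    (hΦ : IsClosed (gph Φ)) {xb : X} {yb : Y} (hfeas : xb ∈ invMap Φ yb)
    (hmin : IsLocalMinOn φ (invMap Φ yb) xb) :
    IsMStationary φ Φ xb yb ∨ ∃ C u ξ₀ x x' ξ xs y lam, 0 ≤ C ∧
      IsApproxMultiplierSeq φ Φ xb yb C u ξ₀ x x' ξ xs y lam := by
  have : ProperSpace X := FiniteDimensional.proper_real X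
  obtain ⟨L, N, hN, hL⟩ := hφ xb
  refine or_iff_not_imp_left.2 fun hM => ?_
  have hδ : ∀ n : ℕ, (0 : ℝ) < 1 / ((n : ℝ) + 1) := fun n => by positivity
  choose x x' ξ xs y lam hnot hx hx' hy hxx hval hprod halign hξ hxs hξL hη using fun n : ℕ =>
    (isMStationary_or_exists_approx_multipliers hφ.continuous hΦ hfeas hmin hN hL
      (hδ n)).resolve_left hM
  have hδ0 : Tendsto (fun n : ℕ => 1 / ((n : ℝ) + 1)) atTop (𝓝 0) :=
    tendsto_one_div_add_atTop_nhds_zero_nat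
  have hx0 : ∀ n, x n - xb ≠ 0 := fun n h0 => (hnot n).1 (by rwa [sub_eq_zero.1 h0])
  obtain ⟨⟨ξ₀, u⟩, -, s, hs, hlim⟩ := tendsto_subseq_of_bounded
    (Metric.isBounded_closedBall (x := (0 : X × X)) (r := max L 1))
    (x := fun n => (ξ n, ‖x n - xb‖⁻¹ • (x n - xb))) (fun n => by
      rw [mem_closedBall_zero_iff, Prod.norm_def]
      refine max_le_max (hξL n) ?_
      rw [norm_smul, norm_inv, norm_norm]
      exact inv_mul_le_one)
  have hs' := hs.tendsto_atTop
  rw [nhds_prod_eq, tendsto_prod_iff'] at hlim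
  obtain ⟨hξ₀, hu⟩ := hlim
  refine ⟨16 * L, u, ξ₀, x ∘ s, x' ∘ s, ξ ∘ s, xs ∘ s, y ∘ s, lam ∘ s, by positivity, ?_⟩
  -- Since `‖x' n - x n‖` is small relative to `‖x n - xb‖`, both sequences share the direction `u`.
  have hdiff : Tendsto (fun n => ‖x' n - xb‖⁻¹ • (x' n - xb) - ‖x n - xb‖⁻¹ • (x n - xb))
      atTop (𝓝 0) := by
    refine squeeze_zero_norm (a := fun n : ℕ => 2 * (1 / ((n : ℝ) + 1))) (fun n => ?_)
      (by simpa using hδ0.const_mul 2)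
    refine (norm_normalize_sub_le (x' n - xb) (hx0 n)).trans ?_
    rw [sub_sub_sub_cancel_right, div_le_iff₀ (norm_pos_iff.2 (hx0 n)), mul_assoc]
    exact mul_le_mul_of_nonneg_left (hxx n) zero_le_two
  exact
    { notMem := fun n => hnot (s n)
      tendsto_x := (tendsto_iff_norm_sub_tendsto_zero.2
        (squeeze_zero (fun _ => norm_nonneg _) hx hδ0)).comp hs'
      tendsto_x' := (tendsto_iff_norm_sub_tendsto_zero.2
        (squeeze_zero (fun _ => norm_nonneg _) hx' hδ0)).comp hs'
      tendsto_y := (tendsto_iff_norm_sub_tendsto_zero.2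
        (squeeze_zero (fun _ => norm_nonneg _) hy hδ0)).comp hs'
      dir := hu
      dir' := by
        have := (hdiff.comp hs').add hu
        rw [zero_add] at this
        exact this.congr fun n => by simp
      value_le := ⟨_, hδ0.comp hs', fun n => hval (s n)⟩
      norm_mul_le := fun n => hprod (s n)
      align := (squeeze_zero_norm halign hδ0).comp hs'
      subgradient := fun n => hξ (s n)
      coderivative := fun n => hxs (s n)
      tendsto_subgradient := hξ₀
      tendsto_coderivative := by
        have := ((squeeze_zero_norm hη hδ0).comp hs').sub hξ₀
        rw [zero_sub] at this
        exact this.congr fun n => by simp }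

end VarAnalysis

theorem theorem4p3 {X Y : Type*}
    [NormedAddCommGroup X] [InnerProductSpace ℝ X] [FiniteDimensional ℝ X]
    [NormedAddCommGroup Y] [InnerProductSpace ℝ Y] [FiniteDimensional ℝ Y]
    (φ : X → ℝ) (hφ : LocallyLipschitz φ)
    (Φ : X → Set Y) (hΦ : IsClosed (gph Φ))
    (xb : X) (yb : Y) (hfeas : xb ∈ invMap Φ yb)
    (hmin : IsLocalMinOn φ (invMap Φ yb) xb)
    (γ : ℝ) (hγ : 1 ≤ γ) :
    (IsMStationary φ Φ xb yb ∨
      (∃ u : X, IsCriticalDirection φ Φ xb yb u ∧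
        0 ∈ limitingSubdiff φ xb + gfrererPseudoCoderivative γ Φ xb yb u 0 0) ∨
      (∃ (u : X) (v lam : Y), IsCriticalDirection φ Φ xb yb u ∧ lam ≠ 0 ∧
        0 ≤ inner ℝ lam v ∧
        0 ∈ limitingSubdiff φ xb + pseudoCoderivative γ Φ xb yb u v lam) ∨
      (∃ u : X, IsCriticalDirection φ Φ xb yb u ∧
        IsApproxStationaryAlong γ φ Φ xb yb u)) ∧
    ((∀ u ∈ Metric.sphere (0 : X) 1 ∩ kerMap (graphicalDerivative Φ xb yb),
        MetricallyPseudoSubregular γ Φ xb yb u) →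
      (IsMStationary φ Φ xb yb ∨
        (∃ u : X, IsCriticalDirection φ Φ xb yb u ∧
          0 ∈ limitingSubdiff φ xb + gfrererPseudoCoderivative γ Φ xb yb u 0 0) ∨
        (∃ (u : X) (v lam : Y), IsCriticalDirection φ Φ xb yb u ∧ lam ≠ 0 ∧
          0 ≤ inner ℝ lam v ∧
          0 ∈ limitingSubdiff φ xb + pseudoCoderivative γ Φ xb yb u v lam))) := by
  rcases isMStationary_or_exists_isApproxMultiplierSeq hφ hΦ hfeas hmin with
    hM | ⟨C, u, ξ₀, x, x', ξ, xs, y, lam, hC, h⟩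
  · exact ⟨Or.inl hM, fun _ => Or.inl hM⟩
  rcases h.stationary_cases γ hφ.continuous hC hfeas with h | h | h | ⟨u, hcrit, h, hu, hsub⟩
  · exact ⟨Or.inl h, fun _ => Or.inl h⟩
  · exact ⟨Or.inr (Or.inl h), fun _ => Or.inr (Or.inl h)⟩
  · exact ⟨Or.inr (Or.inr (Or.inl h)), fun _ => Or.inr (Or.inr h)⟩
  · exact ⟨Or.inr (Or.inr (Or.inr ⟨u, hcrit, h⟩)), fun hreg => absurd (hreg u hu) hsub⟩
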